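/- Let $k$ be a field. A *topological vector space* is a $k$-vector space with a complete separated linear topology (open subspaces form a base of neighbourhoods of $0$). A bilinear map $f:V\times W\to F$ is *$\otimes^!$-continuous* if for every open subspace $Q\subset F$ there are open subspaces $P\subset V$, $P'\subset W$ with $f(P,W)\subset Q$ and $f(V,P')\subset Q$; it is *$\vec\otimes$-continuous* if for every open $Q\subset F$ there is an open $P'\subset W$ with $f(V,P')\subset Q$, and for every $w\in W$ there is an open $P\subset V$ with $f(P,w)\subset Q$. A *topological chiral algebra* is a topological vector space $A$ with an associative unital product that is $\vec\otimes$-continuous. A *commutative filtration* on $A$ is an increasing filtration $A_0\subset A_1\subset\cdots$ by closed subspaces with $\bigcup A_n$ dense, $1\in A_0$, $A_mA_n\subset A_{m+n}$, such that $\mathrm{gr}\,A$ is commutative, i.e. $[A_m,A_n]\subset A_{m+n-1}$ (with $A_{-1}=0$). Morphisms are continuous unital algebra homomorphisms preserving the filtrations; this gives a category $\mathcal{CA}^{fc}$. A *topological chiral Lie algebroid* is a triple $(R,\mathcal L,\mathcal L^\flat)$ where: * $R$ is a topological vector space that is a unital commutative algebra with $\otimes^!$-continuous product; * $\mathcal L$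 is a Lie $R$-algebroid with a separated linear topology (not required to be complete), whose bracket is continuous, whose open Lie subalgebras form a base of neighbourhoods of $0$, and whose $R$-action $R\times\mathcal L\to\mathcal L$ is $\otimes^!$-continuous; * $\mathcal L^\flat$ is a chiral $R$-extension of $\mathcal L$: a topological vector space with a Lie $R$-algebroid structure with continuous bracket, and an exact sequence $0\to R\xrightarrow{i}\mathcal L^\flat\xrightarrow{\pi}\mathcal L\to0$, where $i$ is a closed embedding and a morphism of $R$-modules, $\pi$ is a continuous open surjection and a morphism of Lie $R$-algebroids, $i(1)$ is central, and both the left action $R\times\mathcal L^\flat\to\mathcal L^\flat$ and the right action $\mathcal L^\flat\times R\to\mathcal L^\flat$, $(\ell,r)\mapsto \ell\cdot r:=r\ell+i(\pi(\ell)(r))$, are $\vec\otimes$-continuous. Morphisms are triples of continuous maps compatible with all these structures; this gives a category $\mathcal{CL}$. For $(A,A_\cdot)\in\mathcal{CA}^{fc}$ the triple $(A_0,\mathrm{gr}_1A,A_1)$, with $\mathrm{gr}_1A=A_1/A_0$ carrying the quotient topology and with the brackets and actions given by the product and the commutator of $A$, is a topological chiral Lie algebroid. **Proposition.** The functor $\mathcal{CA}^{fc}\to\mathcal{CL}$,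 $(A,A_\cdot)\mapsto(A_0,\mathrm{gr}_1A,A_1)$, has a left adjoint. The left adjoint sends $(R,\mathcal L,\mathcal L^\flat)$ to the chiral enveloping algebra $U=U^{ch}_R(\mathcal L)^\flat$ with its standard filtration. That is, the map $\varphi:\mathcal L^\flat\to U_1\subset U$ given by the unit of the adjunction is continuous, linear, a morphism of Lie algebras, restricts (via $i$) to a morphism of unital algebras on $R$, is a morphism of $R$-bimodules, and is universal among all such maps from $\mathcal L^\flat$ to topological chiral algebras; and $U_0$ is the closure of $\varphi(i(R))$, while for $n\ge1$, $U_n$ is the closure of $\varphi(\mathcal L^\flat)^n$, the span of the $n$-fold products of elements of $\varphi(\mathcal L^\flat)$. -/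

import Mathlib

open CategoryTheory Topology
open scoped LieRinehartAlgebra

universe u

namespace ChiralTop

section Predicates

/-- A vector space `V` over the (discrete) field `k` with a separated linear topology:
the open vector subspaces form a base of neighbourhoods of `0`. -/
class IsLinearSpace (k V : Type*) [Field k] [AddCommGroup V] [Module k V]
    [TopologicalSpace V] : Prop
    extends IsTopologicalAddGroup V, IsLinearTopology k V, T2Space V

/-- A topological vector space: a complete separated linear topology. -/
class IsTopVect (k V : Type*) [Field k] [AddCommGroup V] [Module k V]
    [TopologicalSpace V] : Prop extends IsLinearSpace k V where
  complete : @CompleteSpace V (IsTopologicalAddGroup.rightUniformSpace V)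

variable (k : Type*) [Field k] {V W F : Type*}
  [AddCommGroup V] [Module k V] [TopologicalSpace V]
  [AddCommGroup W] [Module k W] [TopologicalSpace W]
  [AddCommGroup F] [Module k F] [TopologicalSpace F]

/-- `⊗^!`-continuity of a bilinear map `f`: the preimage in `V ⊗ W` of every open subspace
contains `P ⊗ W + V ⊗ P'` for some open subspaces `P ⊆ V`, `P' ⊆ W`. -/
def IsShriekContinuous (f : V → W → F) : Prop :=
  ∀ Q : Submodule k F, IsOpen (Q : Set F) →
    (∃ P : Submodule k V, IsOpen (P : Set V) ∧ ∀ v ∈ P, ∀ w, f v w ∈ Q) ∧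
    (∃ P' : Submodule k W, IsOpen (P' : Set W) ∧ ∀ v, ∀ w ∈ P', f v w ∈ Q)

/-- Continuity of a bilinear map `f` for the ordered tensor product `V ⊗⃗ W`: the preimage of
every open subspace contains `V ⊗ P'` for some open subspace `P' ⊆ W` and, for each `w : W`,
contains `P ⊗ w` for some open subspace `P ⊆ V` (depending on `w`). -/
def IsArrowContinuous (f : V → W → F) : Prop :=
  ∀ Q : Submodule k F, IsOpen (Q : Set F) →
    (∃ P' : Submodule k W, IsOpen (P' : Set W) ∧ ∀ v, ∀ w ∈ P', f v w ∈ Q) ∧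
    (∀ w, ∃ P : Submodule k V, IsOpen (P : Set V) ∧ ∀ v ∈ P, f v w ∈ Q)

end Predicates

section Helpers

variable {k : Type*} [Field k] {V W : Type*}
  [AddCommGroup V] [Module k V] [TopologicalSpace V]
  [AddCommGroup W] [Module k W] [TopologicalSpace W]

/-- A closed subspace of a topological vector space is a topological vector space. -/
theorem IsTopVect.of_isClosedEmbedding [IsTopVect k W] (f : V →ₗ[k] W)
    (hf : IsClosedEmbedding f) : IsTopVect k V := by
  have hV : IsTopologicalAddGroup V := hf.isInducing.topologicalAddGroup f
  have hlin : IsLinearTopology k V := by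
    refine IsLinearTopology.mk_of_hasBasis (S := Submodule k V) k
      (p := fun N : Submodule k W => (N : Set W) ∈ 𝓝 0)
      (s := fun N => N.comap f) ?_
    rw [hf.isInducing.nhds_eq_comap, map_zero]
    exact (IsLinearTopology.hasBasis_submodule k).comap f
  have hT : T2Space V := hf.isEmbedding.t2Space
  let := IsTopologicalAddGroup.rightUniformSpace V
  let := IsTopologicalAddGroup.rightUniformSpace W
  have : IsUniformAddGroup V := isUniformAddGroup_of_addCommGroup
  have : IsUniformAddGroup W := isUniformAddGroup_of_addCommGroup
  have : CompleteSpace W := ‹IsTopVect k W›.complete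
  have hu : IsUniformInducing f := AddMonoidHom.isUniformInducing_of_isInducing hf.isInducing
  exact { complete := (completeSpace_iff_isComplete_range hu).2 hf.isClosed_range.isComplete }

/-- A subspace which is a neighbourhood of `0` is open. -/
theorem isOpen_of_mem_nhds [IsTopologicalAddGroup V] (S : Submodule k V)
    (h : (S : Set V) ∈ 𝓝 0) : IsOpen (S : Set V) :=
  S.toAddSubgroup.isOpen_of_mem_nhds h

/-- Every neighbourhood of `0` contains an open subspace. -/
theorem exists_open_submodule (k : Type*) [Field k] [Module k V] [IsLinearSpace k V] {U : Set V}
    (hU : U ∈ 𝓝 0) :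
    ∃ S : Submodule k V, IsOpen (S : Set V) ∧ (S : Set V) ⊆ U :=
  (IsLinearTopology.hasBasis_open_submodule k).mem_iff.1 hU

/-- An `⊗⃗`-continuous bilinear map is continuous. -/
theorem IsArrowContinuous.continuous {F : Type*} [AddCommGroup F] [Module k F]
    [TopologicalSpace F] [IsLinearSpace k F] [IsTopologicalAddGroup V] [IsTopologicalAddGroup W]
    (f : V →ₗ[k] W →ₗ[k] F) (hf : IsArrowContinuous k fun v w => f v w) :
    Continuous fun p : V × W => f p.1 p.2 := by
  rw [continuous_iff_continuousAt]
  rintro ⟨v, w⟩ U hU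
  have hU' : (fun y => y + f v w) ⁻¹' U ∈ 𝓝 (0 : F) := by
    refine (continuous_add_const (f v w)).continuousAt.preimage_mem_nhds ?_
    simpa using hU
  obtain ⟨Q, hQ, hQU⟩ := exists_open_submodule k hU'
  obtain ⟨⟨P', hP', h'⟩, h⟩ := hf Q hQ
  obtain ⟨P, hP, h⟩ := h w
  have h₁ : ∀ᶠ p : V × W in 𝓝 (v, w), p.1 - v ∈ P :=
    (continuous_fst.sub continuous_const).continuousAt.preimage_mem_nhds
      (hP.mem_nhds (by simp))
  have h₂ : ∀ᶠ p : V × W in 𝓝 (v, w), p.2 - w ∈ P' :=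
    (continuous_snd.sub continuous_const).continuousAt.preimage_mem_nhds
      (hP'.mem_nhds (by simp))
  change ∀ᶠ p : V × W in 𝓝 (v, w), f p.1 p.2 ∈ U
  filter_upwards [h₁, h₂] with p hp₁ hp₂
  have := hQU (Q.add_mem (h' p.1 _ hp₂) (h _ hp₁))
  simpa using this

end Helpers

/-- `R` is a (unital) topological commutative`^!` algebra over `k`. -/
class IsCommShriekAlgebra (k R : Type*) [Field k] [CommRing R] [Algebra k R]
    [TopologicalSpace R] : Prop extends IsTopVect k R where
  mul_shriek : IsShriekContinuous k (fun r s : R => r * s)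

/-- The topological Lie`^*` algebra axioms on a separated linearly topologized Lie algebra:
continuous bracket, and the open Lie subalgebras form a base of the topology. -/
class IsLieStarAlgebra (k L : Type*) [Field k] [LieRing L] [LieAlgebra k L]
    [TopologicalSpace L] : Prop extends IsLinearSpace k L where
  continuous_lie : Continuous fun p : L × L => ⁅p.1, p.2⁆
  exists_open_subalgebra : ∀ U ∈ 𝓝 (0 : L), ∃ S : LieSubalgebra k L,
    IsOpen (S : Set L) ∧ (S : Set L) ⊆ U

/-- A topological Lie`^*` `R`-algebroid `L`. The algebraic structure (Lie `R`-algebroid) is a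
Lie–Rinehart algebra, whose anchor is the Lie action `⁅x, r⁆` of `L` on `R`. -/
structure LieStarAlgebroid (k : Type u) [Field k] where
  R : Type u
  L : Type u
  [commRing : CommRing R]
  [algebra : Algebra k R]
  [topR : TopologicalSpace R]
  [commShriek : IsCommShriekAlgebra k R]
  [lieRing : LieRing L]
  [lieAlgebra : LieAlgebra k L]
  [module : Module R L]
  [anchor : LieRingModule L R]
  [lieRinehartRing : LieRinehartRing R L]
  [lieRinehart : LieRinehartAlgebra k R L]
  [topL : TopologicalSpace L]
  [lieStar : IsLieStarAlgebra k L]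
  smul_shriek : IsShriekContinuous k (fun (r : R) (x : L) => r • x)

attribute [instance] LieStarAlgebroid.commRing LieStarAlgebroid.algebra LieStarAlgebroid.topR
  LieStarAlgebroid.commShriek LieStarAlgebroid.lieRing LieStarAlgebroid.lieAlgebra
  LieStarAlgebroid.module LieStarAlgebroid.anchor LieStarAlgebroid.lieRinehartRing
  LieStarAlgebroid.lieRinehart LieStarAlgebroid.topL LieStarAlgebroid.lieStar

/-- A topological chiral Lie algebroid `(R, L, E)`: a chiral `R`-extension
`0 → R → E → L → 0` of a topological Lie`^*` `R`-algebroid `L`. -/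
structure ChiralLieAlgebroid (k : Type u) [Field k] extends LieStarAlgebroid k where
  E : Type u
  [lieRingE : LieRing E]
  [lieAlgebraE : LieAlgebra k E]
  [moduleE : Module R E]
  [anchorE : LieRingModule E R]
  [lieRinehartRingE : LieRinehartRing R E]
  [lieRinehartE : LieRinehartAlgebra k R E]
  [topE : TopologicalSpace E]
  [topVectE : IsTopVect k E]
  continuous_lieE : Continuous fun p : E × E => ⁅p.1, p.2⁆
  /-- The embedding `R → E`, a morphism of `R`-modules. -/
  i : R →ₗ[R] E
  /-- The projection `E → L`, a morphism of Lie `R`-algebroids. -/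
  π : E →ₗ⁅AlgHom.id k R⁆ L
  isClosedEmbedding_i : IsClosedEmbedding i
  isOpenQuotientMap_π : IsOpenQuotientMap π
  exact : ∀ x : E, π x = 0 ↔ ∃ r, i r = x
  /-- `1^♭ = i 1` is central. -/
  central : ∀ x : E, ⁅i 1, x⁆ = 0
  /-- The left `R`-action is continuous for `R ⊗⃗ E`. -/
  smul_arrow : IsArrowContinuous k (fun (r : R) (x : E) => r • x)
  /-- The right `R`-action `x · r = r x + π(x)(r)` is continuous for `E ⊗⃗ R`. -/
  right_arrow : IsArrowContinuous k (fun (x : E) (r : R) => r • x + i ⁅π x, r⁆)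

attribute [instance] ChiralLieAlgebroid.lieRingE ChiralLieAlgebroid.lieAlgebraE
  ChiralLieAlgebroid.moduleE ChiralLieAlgebroid.anchorE ChiralLieAlgebroid.lieRinehartRingE
  ChiralLieAlgebroid.lieRinehartE ChiralLieAlgebroid.topE ChiralLieAlgebroid.topVectE

namespace ChiralLieAlgebroid

variable {k : Type u} [Field k]

/-- Morphisms of topological chiral Lie algebroids: continuous maps of all three components,
compatible with all the structures. -/
@[ext]
structure Hom (X Y : ChiralLieAlgebroid k) where
  fR : X.R →A[k] Y.R
  fL : X.L →ₗ⁅(fR : X.R →ₐ[k] Y.R)⁆ Y.L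
  fE : X.E →ₗ⁅(fR : X.R →ₐ[k] Y.R)⁆ Y.E
  continuous_fL : Continuous fL
  continuous_fE : Continuous fE
  comm_i : ∀ r, fE (X.i r) = Y.i (fR r)
  comm_π : ∀ x, Y.π (fE x) = fL (X.π x)

/-- The identity morphism. -/
def Hom.id (X : ChiralLieAlgebroid k) : Hom X X where
  fR := ContinuousAlgHom.id k X.R
  fL := { LieHom.id with
    map_smul_apply' := fun _ _ => rfl
    apply_lie' := fun _ _ => rfl }
  fE := { LieHom.id with
    map_smul_apply' := fun _ _ => rfl
    apply_lie' := fun _ _ => rfl }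
  continuous_fL := continuous_id
  continuous_fE := continuous_id
  comm_i _ := rfl
  comm_π _ := rfl

/-- Composition of morphisms. -/
def Hom.comp {X Y Z : ChiralLieAlgebroid k} (f : Hom X Y) (g : Hom Y Z) : Hom X Z where
  fR := g.fR.comp f.fR
  fL := { g.fL.toLieHom.comp f.fL.toLieHom with
    map_smul_apply' := fun a x =>
      (congrArg g.fL (f.fL.map_smul_apply a x)).trans (g.fL.map_smul_apply _ _)
    apply_lie' := fun a x =>
      (congrArg g.fR (f.fL.apply_lie a x)).trans (g.fL.apply_lie _ _) }
  fE := { g.fE.toLieHom.comp f.fE.toLieHom with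
    map_smul_apply' := fun a x =>
      (congrArg g.fE (f.fE.map_smul_apply a x)).trans (g.fE.map_smul_apply _ _)
    apply_lie' := fun a x =>
      (congrArg g.fR (f.fE.apply_lie a x)).trans (g.fE.apply_lie _ _) }
  continuous_fL := g.continuous_fL.comp f.continuous_fL
  continuous_fE := g.continuous_fE.comp f.continuous_fE
  comm_i r := (congrArg g.fE (f.comm_i r)).trans (g.comm_i _)
  comm_π x := (g.comm_π _).trans (congrArg g.fL (f.comm_π x))

/-- The category of topological chiral Lie algebroids. -/
instance : Category (ChiralLieAlgebroid k) where
  Hom := Hom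
  id := Hom.id
  comp := Hom.comp
  id_comp _ := rfl
  comp_id _ := rfl
  assoc _ _ _ := rfl

/-- A morphism is determined by its underlying maps. -/
theorem Hom.ext' {X Y : ChiralLieAlgebroid k} {f g : Hom X Y} (hR : ∀ r, f.fR r = g.fR r)
    (hL : ∀ x, f.fL x = g.fL x) (hE : ∀ x, f.fE x = g.fE x) : f = g := by
  obtain ⟨fR, ⟨fL, _, _⟩, ⟨fE, _, _⟩, _, _, _, _⟩ := f
  obtain ⟨gR, ⟨gL, _, _⟩, ⟨gE, _, _⟩, _, _, _, _⟩ := g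
  obtain rfl : fR = gR := ContinuousAlgHom.ext hR
  obtain rfl : fL = gL := LieHom.ext hL
  obtain rfl : fE = gE := LieHom.ext hE
  rfl

end ChiralLieAlgebroid

/-- A topological chiral algebra: a topological vector space with a unital associative product
that is continuous for `A ⊗⃗ A`. -/
structure ChiralAlgebra (k : Type u) [Field k] where
  carrier : Type u
  [ring : Ring carrier]
  [algebra : Algebra k carrier]
  [top : TopologicalSpace carrier]
  [topVect : IsTopVect k carrier]
  mul_arrow : IsArrowContinuous k (fun a b : carrier => a * b)

instance (k : Type u) [Field k] : CoeSort (ChiralAlgebra k) (Type u) := ⟨ChiralAlgebra.carrier⟩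

attribute [instance] ChiralAlgebra.ring ChiralAlgebra.algebra ChiralAlgebra.top
  ChiralAlgebra.topVect

/-- A topological chiral algebra with a commutative filtration: an increasing filtration
`fil 0 ⊆ fil 1 ⊆ …` by closed subspaces with dense union, compatible with the product, with
commutative associated graded algebra. -/
structure FilteredChiralAlgebra (k : Type u) [Field k] extends ChiralAlgebra k where
  fil : ℕ → Submodule k carrier
  mono : Monotone fil
  isClosed_fil : ∀ n, IsClosed (fil n : Set carrier)
  dense_fil : Dense (⋃ n, (fil n : Set carrier))
  one_mem : 1 ∈ fil 0
  mul_mem : ∀ m n, ∀ a ∈ fil m, ∀ b ∈ fil n, a * b ∈ fil (m + n)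
  /-- Commutativity of `gr`: the commutator of `fil m` and `fil n` lies in `fil (m + n - 1)`,
  where `fil (-1) = 0`. -/
  comm_zero : ∀ a ∈ fil 0, ∀ b ∈ fil 0, a * b = b * a
  comm_succ : ∀ m n l, m + n = l + 1 → ∀ a ∈ fil m, ∀ b ∈ fil n, a * b - b * a ∈ fil l

namespace FilteredChiralAlgebra

variable {k : Type u} [Field k]

/-- Morphisms: continuous unital algebra homomorphisms that preserve the filtrations. -/
@[ext]
structure Hom (A B : FilteredChiralAlgebra k) where
  toAlgHom : A.carrier →A[k] B.carrier
  map_fil : ∀ n, ∀ a ∈ A.fil n, toAlgHom a ∈ B.fil n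

/-- The category of topological chiral algebras with a commutative filtration. -/
instance : Category (FilteredChiralAlgebra k) where
  Hom := Hom
  id A := ⟨ContinuousAlgHom.id k A.carrier, fun _ _ h => h⟩
  comp f g := ⟨g.toAlgHom.comp f.toAlgHom, fun n a h => g.map_fil n _ (f.map_fil n a h)⟩
  id_comp _ := rfl
  comp_id _ := rfl
  assoc _ _ _ := rfl

variable (A : FilteredChiralAlgebra k)

/-- `A₀` as a subalgebra of `A`. -/
def A₀ : Subalgebra k A.carrier where
  carrier := A.fil 0
  mul_mem' ha hb := A.mul_mem 0 0 _ ha _ hb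
  add_mem' ha hb := (A.fil 0).add_mem ha hb
  algebraMap_mem' c := by
    rw [Algebra.algebraMap_eq_smul_one]
    exact (A.fil 0).smul_mem c A.one_mem

instance : CommRing A.A₀ :=
  { (inferInstance : Ring A.A₀) with
    mul_comm := fun a b => Subtype.ext (A.comm_zero _ a.2 _ b.2) }

/-- `A₁` as a vector space. -/
abbrev A₁ : Type u := A.fil 1

/-- The left `A₀`-module structure on `A₁`, by multiplication in `A`. -/
instance : Module A.A₀ A.A₁ where
  smul r x := ⟨(r : A.carrier) * x, by simpa using A.mul_mem 0 1 _ r.2 _ x.2⟩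
  one_smul x := Subtype.ext (one_mul _)
  mul_smul r s x := Subtype.ext (mul_assoc _ _ _)
  smul_zero r := Subtype.ext (mul_zero _)
  smul_add r x y := Subtype.ext (mul_add _ _ _)
  add_smul r s x := Subtype.ext (add_mul _ _ _)
  zero_smul x := Subtype.ext (zero_mul _)

@[simp] theorem coe_smul₁ (r : A.A₀) (x : A.A₁) :
    ((r • x : A.A₁) : A.carrier) = (r : A.carrier) * x := rfl

/-- The commutator bracket on `A₁`. -/
instance : LieRing A.A₁ where
  bracket x y := ⟨(x : A.carrier) * y - y * x, A.comm_succ 1 1 1 rfl _ x.2 _ y.2⟩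
  add_lie x y z := Subtype.ext (by
    change ((x : A.carrier) + y) * z - z * (x + y) = (x * z - z * x) + (y * z - z * y)
    noncomm_ring)
  lie_add x y z := Subtype.ext (by
    change (x : A.carrier) * (y + z) - (y + z) * x = (x * y - y * x) + (x * z - z * x)
    noncomm_ring)
  lie_self x := Subtype.ext (sub_self _)
  leibniz_lie x y z := Subtype.ext (by
    change (x : A.carrier) * (y * z - z * y) - (y * z - z * y) * x
      = ((x * y - y * x) * z - z * (x * y - y * x)) + (y * (x * z - z * x) - (x * z - z * x) * y)
    noncomm_ring)

@[simp] theorem coe_lie₁ (x y : A.A₁) :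
    ((⁅x, y⁆ : A.A₁) : A.carrier) = (x : A.carrier) * y - y * x := rfl

instance : LieAlgebra k A.A₁ where
  lie_smul c x y := Subtype.ext (by simp [smul_sub])

instance : IsScalarTower k A.A₀ A.A₁ where
  smul_assoc c r x := Subtype.ext (by simp)

/-- The adjoint action of `A₁` on `A₀`. -/
instance : LieRingModule A.A₁ A.A₀ where
  bracket x r := ⟨(x : A.carrier) * r - r * x, A.comm_succ 1 0 0 rfl _ x.2 _ r.2⟩
  add_lie x y z := Subtype.ext (by
    change ((x : A.carrier) + y) * z - z * (x + y) = (x * z - z * x) + (y * z - z * y)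
    noncomm_ring)
  lie_add x y z := Subtype.ext (by
    change (x : A.carrier) * (y + z) - (y + z) * x = (x * y - y * x) + (x * z - z * x)
    noncomm_ring)
  leibniz_lie x y z := Subtype.ext (by
    change (x : A.carrier) * (y * z - z * y) - (y * z - z * y) * x
      = ((x * y - y * x) * z - z * (x * y - y * x)) + (y * (x * z - z * x) - (x * z - z * x) * y)
    noncomm_ring)

@[simp] theorem coe_lie₀ (x : A.A₁) (r : A.A₀) :
    ((⁅x, r⁆ : A.A₀) : A.carrier) = (x : A.carrier) * r - r * x := rfl

instance : LieRinehartRing A.A₀ A.A₁ where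
  lie_smul_eq_mul' a b x := Subtype.ext (by
    have h := A.comm_zero _ a.2 _ b.2
    simp only [coe_lie₀, coe_smul₁, MulMemClass.coe_mul]
    rw [mul_sub, ← mul_assoc (b : A.carrier), ← h]
    noncomm_ring)
  leibniz_mul_right' x a b := Subtype.ext (by
    simp only [coe_lie₀, smul_eq_mul, MulMemClass.coe_mul, AddMemClass.coe_add]
    noncomm_ring)
  leibniz_smul_right' x y a := Subtype.ext (by
    change (x : A.carrier) * (a * y) - a * y * x
      = a * (x * y - y * x) + (x * a - a * x) * y
    noncomm_ring)

instance : LieRinehartAlgebra k A.A₀ A.A₁ where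
  smul_lie c x r := Subtype.ext (by simp [smul_sub])
  lie_smul c x r := Subtype.ext (by simp [smul_sub])

/-- The inclusion `A₀ → A₁`. -/
def incl : A.A₀ →ₗ[A.A₀] A.A₁ where
  toFun r := ⟨r, A.mono zero_le_one r.2⟩
  map_add' _ _ := rfl
  map_smul' _ _ := rfl

@[simp] theorem coe_incl (r : A.A₀) : (A.incl r : A.carrier) = r := rfl

/-- `gr₁ A = A₁ / A₀`, with the quotient topology. -/
abbrev gr₁ : Type u := A.A₁ ⧸ LinearMap.range A.incl

theorem mem_range_incl {x : A.A₁} : x ∈ LinearMap.range A.incl ↔ (x : A.carrier) ∈ A.fil 0 :=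
  ⟨fun ⟨r, hr⟩ => hr ▸ r.2, fun h => ⟨⟨x, h⟩, rfl⟩⟩


theorem lie_mem_range_incl (x : A.A₁) {y : A.A₁} (hy : y ∈ LinearMap.range A.incl) :
    ⁅x, y⁆ ∈ LinearMap.range A.incl := by
  rw [mem_range_incl] at hy ⊢
  exact A.comm_succ 1 0 0 rfl _ x.2 _ hy

theorem lie_mem_range_incl' {x : A.A₁} (hx : x ∈ LinearMap.range A.incl) (y : A.A₁) :
    ⁅x, y⁆ ∈ LinearMap.range A.incl := by
  rw [mem_range_incl] at hx ⊢
  exact A.comm_succ 0 1 0 rfl _ hx _ y.2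

/-- The bracket on `gr₁ A` induced by the commutator. -/
instance : LieRing A.gr₁ where
  bracket := Quotient.map₂ (fun x y => ⁅x, y⁆) (by
    intro x x' hx y y' hy
    refine (Submodule.quotientRel_def _).2 ?_
    have hx' := A.lie_mem_range_incl' ((Submodule.quotientRel_def _).1 hx) y
    have hy' := A.lie_mem_range_incl x' ((Submodule.quotientRel_def _).1 hy)
    rw [sub_lie] at hx'
    rw [lie_sub] at hy'
    simpa using add_mem hx' hy')
  add_lie := by
    rintro ⟨x⟩ ⟨y⟩ ⟨z⟩
    exact congrArg (Submodule.Quotient.mk (p := LinearMap.range A.incl)) (add_lie x y z)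
  lie_add := by
    rintro ⟨x⟩ ⟨y⟩ ⟨z⟩
    exact congrArg (Submodule.Quotient.mk (p := LinearMap.range A.incl)) (lie_add x y z)
  lie_self := by
    rintro ⟨x⟩
    exact congrArg (Submodule.Quotient.mk (p := LinearMap.range A.incl)) (lie_self x)
  leibniz_lie := by
    rintro ⟨x⟩ ⟨y⟩ ⟨z⟩
    exact congrArg (Submodule.Quotient.mk (p := LinearMap.range A.incl)) (leibniz_lie x y z)

instance : LieAlgebra k A.gr₁ where
  lie_smul c := by
    rintro ⟨x⟩ ⟨y⟩
    exact congrArg (Submodule.Quotient.mk (p := LinearMap.range A.incl)) (lie_smul c x y)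

/-- The anchor of `gr₁ A`: the action on `A₀` induced by the adjoint action of `A₁`. -/
instance : LieRingModule A.gr₁ A.A₀ where
  bracket x r := Quotient.liftOn x (fun x => ⁅x, r⁆) (by
    intro x x' hx
    obtain ⟨s, hs⟩ := (Submodule.quotientRel_def _).1 hx
    rw [← sub_eq_zero, ← sub_lie, ← hs]
    exact Subtype.ext (sub_eq_zero.2 (A.comm_zero _ s.2 _ r.2)))
  add_lie := by
    rintro ⟨x⟩ ⟨y⟩ r
    exact add_lie x y r
  lie_add := by
    rintro ⟨x⟩ r s
    exact lie_add x r s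
  leibniz_lie := by
    rintro ⟨x⟩ ⟨y⟩ r
    exact leibniz_lie x y r

instance : LieRinehartRing A.A₀ A.gr₁ where
  lie_smul_eq_mul' a b := by
    rintro ⟨x⟩
    exact LieRinehartRing.lie_smul_eq_mul a b x
  leibniz_mul_right' := by
    rintro ⟨x⟩ a b
    exact LieRinehartRing.leibniz_mul_right x a b
  leibniz_smul_right' := by
    rintro ⟨x⟩ ⟨y⟩ a
    exact congrArg (Submodule.Quotient.mk (p := LinearMap.range A.incl))
      (LieRinehartRing.leibniz_smul_right x y a)

instance : LieRinehartAlgebra k A.A₀ A.gr₁ where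
  smul_lie c := by
    rintro ⟨x⟩ r
    exact smul_lie c x r
  lie_smul c := by
    rintro ⟨x⟩ r
    exact lie_smul c x r

/-- The projection `A₁ → gr₁ A`, a morphism of Lie `A₀`-algebroids. -/
def proj : A.A₁ →ₗ⁅AlgHom.id k A.A₀⁆ A.gr₁ where
  toFun := Submodule.Quotient.mk
  map_add' _ _ := rfl
  map_smul' _ _ := rfl
  map_lie' := rfl
  map_smul_apply' _ _ := rfl
  apply_lie' _ _ := rfl

theorem continuous_mul : Continuous fun p : A.carrier × A.carrier => p.1 * p.2 :=
  IsArrowContinuous.continuous (LinearMap.mul k A.carrier) A.mul_arrow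

/-- The open left ideals of `A` form a base of the topology. -/
theorem exists_open_leftIdeal {U : Set A.carrier} (hU : U ∈ 𝓝 0) :
    ∃ J : Submodule k A.carrier, IsOpen (J : Set A.carrier) ∧ (J : Set A.carrier) ⊆ U ∧
      ∀ b, ∀ a ∈ J, b * a ∈ J := by
  obtain ⟨Q, hQ, hQU⟩ := exists_open_submodule k hU
  obtain ⟨P, hP, hPQ⟩ := (A.mul_arrow Q hQ).1
  let J : Submodule k A.carrier :=
    { carrier := {a | ∀ b, b * a ∈ Q}
      add_mem' := fun ha hb c => by rw [mul_add]; exact Q.add_mem (ha c) (hb c)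
      zero_mem' := fun c => by rw [mul_zero]; exact Q.zero_mem
      smul_mem' := fun t a ha c => by rw [mul_smul_comm]; exact Q.smul_mem t (ha c) }
  refine ⟨J, isOpen_of_mem_nhds J ?_, fun a ha => hQU (by simpa using ha 1), fun b a ha c => ?_⟩
  · exact Filter.mem_of_superset (hP.mem_nhds P.zero_mem) fun a ha b => hPQ b a ha
  · rw [← mul_assoc]; exact ha _

instance : IsTopVect k A.A₁ :=
  IsTopVect.of_isClosedEmbedding (A.fil 1).subtype (A.isClosed_fil 1).isClosedEmbedding_subtypeVal

instance : IsTopVect k A.A₀ :=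
  IsTopVect.of_isClosedEmbedding A.A₀.val.toLinearMap
    (A.isClosed_fil 0).isClosedEmbedding_subtypeVal

/-- Continuous preimage of an open subspace under the inclusion of `A₀`. -/
theorem isOpen_comap₀ {P : Submodule k A.carrier} (hP : IsOpen (P : Set A.carrier)) :
    IsOpen ((P.comap A.A₀.val.toLinearMap : Submodule k A.A₀) : Set A.A₀) :=
  hP.preimage continuous_subtype_val

theorem isOpen_comap₁ {P : Submodule k A.carrier} (hP : IsOpen (P : Set A.carrier)) :
    IsOpen ((P.comap (A.fil 1).subtype : Submodule k A.A₁) : Set A.A₁) :=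
  hP.preimage continuous_subtype_val

/-- An open subspace of `A₀` contains the trace of an open left ideal of `A`. -/
theorem exists_leftIdeal₀ {Q : Submodule k A.A₀} (hQ : IsOpen (Q : Set A.A₀)) :
    ∃ J : Submodule k A.carrier, IsOpen (J : Set A.carrier) ∧
      (∀ r : A.A₀, (r : A.carrier) ∈ J → r ∈ Q) ∧ ∀ b, ∀ a ∈ J, b * a ∈ J := by
  obtain ⟨U, hU, hUQ⟩ := isOpen_induced_iff.1 hQ
  have h0 : (0 : A.A₀) ∈ Subtype.val ⁻¹' U := hUQ ▸ Q.zero_mem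
  obtain ⟨J, hJ, hJU, hJ'⟩ := A.exists_open_leftIdeal (hU.mem_nhds h0)
  exact ⟨J, hJ, fun r hr => (Set.ext_iff.1 hUQ r).1 (hJU hr), hJ'⟩

/-- An open subspace of `A₁` contains the trace of an open left ideal of `A`. -/
theorem exists_leftIdeal₁ {Q : Set A.A₁} (hQ : IsOpen Q) (hQ0 : (0 : A.A₁) ∈ Q) :
    ∃ J : Submodule k A.carrier, IsOpen (J : Set A.carrier) ∧
      (∀ r : A.A₁, (r : A.carrier) ∈ J → r ∈ Q) ∧ ∀ b, ∀ a ∈ J, b * a ∈ J := by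
  obtain ⟨U, hU, rfl⟩ := isOpen_induced_iff.1 hQ
  obtain ⟨J, hJ, hJU, hJ'⟩ := A.exists_open_leftIdeal (hU.mem_nhds hQ0)
  exact ⟨J, hJ, fun r hr => hJU hr, hJ'⟩

/-- Right multiplications are continuous. -/
theorem exists_mul_right {J : Submodule k A.carrier} (hJ : IsOpen (J : Set A.carrier))
    (b : A.carrier) : ∃ P : Submodule k A.carrier, IsOpen (P : Set A.carrier) ∧
      ∀ a ∈ P, a * b ∈ J :=
  (A.mul_arrow J hJ).2 b

instance : IsCommShriekAlgebra k A.A₀ where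
  mul_shriek Q hQ := by
    obtain ⟨J, hJ, hJQ, hJ'⟩ := A.exists_leftIdeal₀ hQ
    refine ⟨⟨_, A.isOpen_comap₀ hJ, fun v hv w => ?_⟩, ⟨_, A.isOpen_comap₀ hJ, fun v w hw => ?_⟩⟩
    · change v * w ∈ Q
      rw [mul_comm]; exact hJQ _ (hJ' _ _ hv)
    · exact hJQ _ (hJ' _ _ hw)

theorem continuous_proj : Continuous A.proj :=
  (LinearMap.range A.incl).continuous_mkQ

theorem isOpenQuotientMap_proj : IsOpenQuotientMap A.proj :=
  (LinearMap.range A.incl).isOpenQuotientMap_mkQ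

theorem isClosed_range_incl : IsClosed (LinearMap.range A.incl : Set A.A₁) := by
  have : (LinearMap.range A.incl : Set A.A₁) = Subtype.val ⁻¹' (A.fil 0 : Set A.carrier) :=
    Set.ext fun _ => A.mem_range_incl
  rw [this]
  exact (A.isClosed_fil 0).preimage continuous_subtype_val

theorem isClosedEmbedding_incl : IsClosedEmbedding A.incl where
  eq_induced := by
    rw [instTopologicalSpaceSubtype, instTopologicalSpaceSubtype, induced_compose]
    rfl
  injective := fun r s h => Subtype.ext (congrArg (fun x : A.A₁ => (x : A.carrier)) h)
  isClosed_range := A.isClosed_range_incl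

theorem proj_eq_zero {x : A.A₁} : A.proj x = 0 ↔ ∃ r, A.incl r = x :=
  Submodule.Quotient.mk_eq_zero _

theorem continuous_lie₁ : Continuous fun p : A.A₁ × A.A₁ => ⁅p.1, p.2⁆ := by
  have h := A.continuous_mul
  refine Continuous.subtype_mk (Continuous.sub ?_ ?_) _
  · exact h.comp ((continuous_subtype_val.comp continuous_fst).prodMk
      (continuous_subtype_val.comp continuous_snd))
  · exact h.comp ((continuous_subtype_val.comp continuous_snd).prodMk
      (continuous_subtype_val.comp continuous_fst))

theorem continuous_lie_gr₁ : Continuous fun p : A.gr₁ × A.gr₁ => ⁅p.1, p.2⁆ := by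
  rw [← (A.isOpenQuotientMap_proj.prodMap A.isOpenQuotientMap_proj).continuous_comp_iff]
  exact A.continuous_proj.comp A.continuous_lie₁

instance : IsLinearSpace k A.gr₁ :=
  have : IsClosed (LinearMap.range A.incl : Set A.A₁) := A.isClosed_range_incl
  { toIsTopologicalAddGroup := inferInstance
    toT2Space := inferInstance
    toIsLinearTopology := by
      refine IsLinearTopology.mk_of_hasBasis (S := Submodule k A.gr₁) k
        (p := fun N : Submodule k A.A₁ => IsOpen (N : Set A.A₁))
        (s := fun N => N.map A.proj.toLieHom.toLinearMap) ?_
      rw [← map_zero A.proj.toLieHom]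
      rw [← A.isOpenQuotientMap_proj.map_nhds_eq]
      exact (IsLinearTopology.hasBasis_open_submodule k).map _ }

instance : IsLieStarAlgebra k A.gr₁ where
  continuous_lie := A.continuous_lie_gr₁
  exists_open_subalgebra U hU := by
    obtain ⟨V, hVU, hV, hV0⟩ := mem_nhds_iff.1 hU
    obtain ⟨J, hJ, hJV, hJ'⟩ := A.exists_leftIdeal₁ (hV.preimage A.continuous_proj) hV0
    let S : LieSubalgebra k A.A₁ :=
      { J.comap (A.fil 1).subtype with
        lie_mem' := fun {x y} hx hy => J.sub_mem (hJ' _ _ hy) (hJ' _ _ hx) }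
    refine ⟨S.map A.proj.toLieHom, ?_, ?_⟩
    · exact A.isOpenQuotientMap_proj.isOpenMap _ (A.isOpen_comap₁ hJ)
    · rintro _ ⟨x, hx, rfl⟩
      exact hVU (hJV x hx)

theorem smul_shriek_gr₁ : IsShriekContinuous k fun (r : A.A₀) (x : A.gr₁) => r • x := by
  intro Q hQ
  obtain ⟨J, hJ, hJQ, hJ'⟩ := A.exists_leftIdeal₁ (hQ.preimage A.continuous_proj) Q.zero_mem
  refine ⟨⟨_, A.isOpen_comap₀ hJ, ?_⟩,
    ⟨(J.comap (A.fil 1).subtype).map A.proj.toLieHom.toLinearMap,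
      A.isOpenQuotientMap_proj.isOpenMap _ (A.isOpen_comap₁ hJ), ?_⟩⟩
  · intro r hr x
    obtain ⟨x, rfl⟩ := A.isOpenQuotientMap_proj.surjective x
    have hxr : (x : A.carrier) * r ∈ A.fil 1 := A.mul_mem 1 0 _ x.2 _ r.2
    have h₁ : A.proj ⟨_, hxr⟩ ∈ Q := hJQ ⟨_, hxr⟩ (hJ' _ _ hr)
    have h₂ : A.proj (r • x) = A.proj ⟨_, hxr⟩ := by
      rw [← sub_eq_zero, ← map_sub, A.proj_eq_zero]
      exact A.mem_range_incl.2 (A.comm_succ 0 1 0 rfl _ r.2 _ x.2)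
    change A.proj (r • x) ∈ Q
    rw [h₂]
    exact h₁
  · rintro r _ ⟨x, hx, rfl⟩
    exact hJQ (r • x) (hJ' _ _ hx)

theorem smul_arrow₁ : IsArrowContinuous k fun (r : A.A₀) (x : A.A₁) => r • x := by
  intro Q hQ
  obtain ⟨J, hJ, hJQ, hJ'⟩ := A.exists_leftIdeal₁ hQ Q.zero_mem
  refine ⟨⟨_, A.isOpen_comap₁ hJ, fun r x hx => hJQ _ (hJ' _ _ hx)⟩, fun x => ?_⟩
  obtain ⟨P, hP, h⟩ := A.exists_mul_right hJ x
  exact ⟨_, A.isOpen_comap₀ hP, fun r hr => hJQ _ (h _ hr)⟩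

/-- The right action `r x + π(x)(r)` on `A₁` is right multiplication. -/
theorem coe_right (x : A.A₁) (r : A.A₀) :
    ((r • x + A.incl ⁅A.proj x, r⁆ : A.A₁) : A.carrier) = x * r := by
  change (r : A.carrier) * x + (x * r - r * x) = x * r
  abel

theorem right_arrow₁ :
    IsArrowContinuous k fun (x : A.A₁) (r : A.A₀) => r • x + A.incl ⁅A.proj x, r⁆ := by
  intro Q hQ
  obtain ⟨J, hJ, hJQ, hJ'⟩ := A.exists_leftIdeal₁ hQ Q.zero_mem
  refine ⟨⟨_, A.isOpen_comap₀ hJ, fun x r hr => hJQ _ ?_⟩, fun r => ?_⟩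
  · rw [coe_right]; exact hJ' _ _ hr
  · obtain ⟨P, hP, h⟩ := A.exists_mul_right hJ r
    refine ⟨_, A.isOpen_comap₁ hP, fun x hx => hJQ _ ?_⟩
    rw [coe_right]; exact h _ hx

/-- The topological chiral Lie algebroid `(A₀, gr₁ A, A₁)`. -/
def toAlgebroid : ChiralLieAlgebroid k where
  R := A.A₀
  L := A.gr₁
  smul_shriek := A.smul_shriek_gr₁
  E := A.A₁
  continuous_lieE := A.continuous_lie₁
  i := A.incl
  π := A.proj
  isClosedEmbedding_i := A.isClosedEmbedding_incl
  isOpenQuotientMap_π := A.isOpenQuotientMap_proj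
  exact _ := A.proj_eq_zero
  central x := Subtype.ext (by
    change (1 : A.carrier) * x - x * 1 = 0
    simp)
  smul_arrow := A.smul_arrow₁
  right_arrow := A.right_arrow₁

variable {A} {B : FilteredChiralAlgebra k} (f : Hom A B)

/-- The map `A₀ → B₀` induced by a morphism. -/
def Hom.map₀ : A.A₀ →A[k] B.A₀ where
  toFun r := ⟨f.toAlgHom r, f.map_fil 0 _ r.2⟩
  map_one' := Subtype.ext (map_one f.toAlgHom)
  map_mul' _ _ := Subtype.ext (map_mul f.toAlgHom _ _)
  map_zero' := Subtype.ext (map_zero f.toAlgHom)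
  map_add' _ _ := Subtype.ext (map_add f.toAlgHom _ _)
  commutes' c := Subtype.ext (f.toAlgHom.commutes' c)
  cont := (f.toAlgHom.cont.comp continuous_subtype_val).subtype_mk _

/-- The map `A₁ → B₁` induced by a morphism. -/
def Hom.map₁ : A.A₁ →ₗ⁅(f.map₀ : A.A₀ →ₐ[k] B.A₀)⁆ B.A₁ where
  toFun x := ⟨f.toAlgHom x, f.map_fil 1 _ x.2⟩
  map_add' _ _ := Subtype.ext (map_add f.toAlgHom _ _)
  map_smul' c x := Subtype.ext (map_smul f.toAlgHom c _)
  map_lie' {x y} := Subtype.ext (by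
    change f.toAlgHom ((x : A.carrier) * y - y * x) = _
    rw [map_sub, map_mul, map_mul]
    rfl)
  map_smul_apply' r x := Subtype.ext (map_mul f.toAlgHom _ _)
  apply_lie' r x := Subtype.ext (by
    change f.toAlgHom ((x : A.carrier) * r - r * x) = _
    rw [map_sub, map_mul, map_mul]
    rfl)

theorem Hom.map₁_incl (r : A.A₀) : f.map₁ (A.incl r) = B.incl (f.map₀ r) := rfl

theorem Hom.continuous_map₁ : Continuous f.map₁ :=
  (f.toAlgHom.cont.comp continuous_subtype_val).subtype_mk _

/-- The map `gr₁ A → gr₁ B` induced by a morphism. -/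
def Hom.mapGr : A.gr₁ →ₗ⁅(f.map₀ : A.A₀ →ₐ[k] B.A₀)⁆ B.gr₁ where
  toFun x := Quotient.liftOn x (fun x => B.proj (f.map₁ x)) (by
    intro x y h
    obtain ⟨r, hr⟩ := (Submodule.quotientRel_def _).1 h
    rw [← sub_eq_zero, ← map_sub, ← map_sub, ← hr]
    exact B.proj_eq_zero.2 ⟨f.map₀ r, rfl⟩)
  map_add' := by
    rintro ⟨x⟩ ⟨y⟩
    exact congrArg B.proj (map_add f.map₁.toLieHom x y)
  map_smul' c := by
    rintro ⟨x⟩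
    exact congrArg B.proj (map_smul f.map₁.toLieHom c x)
  map_lie' {x y} := by
    obtain ⟨x, rfl⟩ := A.isOpenQuotientMap_proj.surjective x
    obtain ⟨y, rfl⟩ := A.isOpenQuotientMap_proj.surjective y
    exact congrArg B.proj (LieHom.map_lie f.map₁.toLieHom x y)
  map_smul_apply' r := by
    rintro ⟨x⟩
    exact congrArg B.proj (f.map₁.map_smul_apply r x)
  apply_lie' r := by
    rintro ⟨x⟩
    exact f.map₁.apply_lie r x

theorem Hom.mapGr_proj (x : A.A₁) : B.proj (f.map₁ x) = f.mapGr (A.proj x) := rfl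

theorem Hom.continuous_mapGr : Continuous f.mapGr := by
  rw [← A.isOpenQuotientMap_proj.continuous_comp_iff]
  exact B.continuous_proj.comp f.continuous_map₁

variable (k) in
/-- The functor `(A, A_·) ↦ (A₀, gr₁ A, A₁)`. -/
def algebroidFunctor : FilteredChiralAlgebra k ⥤ ChiralLieAlgebroid k where
  obj A := A.toAlgebroid
  map {A B} f :=
    { fR := Hom.map₀ f
      fL := Hom.mapGr f
      fE := Hom.map₁ f
      continuous_fL := Hom.continuous_mapGr f
      continuous_fE := Hom.continuous_map₁ f
      comm_i := Hom.map₁_incl f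
      comm_π := Hom.mapGr_proj f }
  map_id A := ChiralLieAlgebroid.Hom.ext' (fun _ => rfl) (by rintro ⟨x⟩; rfl) (fun _ => rfl)
  map_comp f g := ChiralLieAlgebroid.Hom.ext' (fun _ => rfl) (by rintro ⟨x⟩; rfl) (fun _ => rfl)

end FilteredChiralAlgebra

section Envelope

variable {k : Type u} [Field k]

/-- The data that the chiral enveloping algebra of `X = (R, L, E)` classifies: a continuous linear
map `φ : E → B` to a topological chiral algebra which is a morphism of Lie algebras, whose
restriction to `R` is a morphism of unital algebras, and which is a morphism of `R`-bimodules. -/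
structure EnvelopingMap (X : ChiralLieAlgebroid k) (B : ChiralAlgebra k) where
  φ : X.E →L[k] B
  map_lie : ∀ x y, φ ⁅x, y⁆ = φ x * φ y - φ y * φ x
  map_one : φ (X.i 1) = 1
  map_mul : ∀ r s, φ (X.i (r * s)) = φ (X.i r) * φ (X.i s)
  map_smul_left : ∀ (r : X.R) (x : X.E), φ (r • x) = φ (X.i r) * φ x
  map_smul_right : ∀ (x : X.E) (r : X.R), φ (r • x + X.i ⁅X.π x, r⁆) = φ x * φ (X.i r)

/-- `(U, η)` is the chiral enveloping algebra of `X`: the universal topological chiral algebra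
with an enveloping map. -/
def IsChiralEnvelope (X : ChiralLieAlgebroid k) (U : ChiralAlgebra k)
    (η : EnvelopingMap X U) : Prop :=
  ∀ (B : ChiralAlgebra k) (ψ : EnvelopingMap X B),
    ∃! f : U.carrier →A[k] B.carrier, ∀ x, f (η.φ x) = ψ.φ x

/-- The filtration of `U` is the standard one: `U₀` is the closure of the image of `R`, and `Uₙ`
for `n ≥ 1` is the closure of the `n`-th power of the image of `E`. -/
def IsStandardFiltration (X : ChiralLieAlgebroid k) (U : FilteredChiralAlgebra k)
    (η : EnvelopingMap X U.toChiralAlgebra) : Prop :=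
  (U.fil 0 : Set U.carrier) = closure (Set.range fun r => η.φ (X.i r)) ∧
  ∀ n, 1 ≤ n → (U.fil n : Set U.carrier) =
    closure ((LinearMap.range η.φ.toLinearMap ^ n : Submodule k U.carrier) : Set U.carrier)

end Envelope

end ChiralTop

/-!
The left adjoint is built from the tensor algebra `T` of the vector space `E`. In a topological
chiral algebra the open *left* ideals form a base of neighbourhoods of `0`, and right
multiplications are continuous; conversely, these two properties of a complete separated topological
algebra give back the `⊗⃗`-continuity of the product (`ChiralAlgebra.ofLeftIdeals`). So the
topology to put on `T` is the finest one of this kind for which `E → T` is continuous and the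
defining relations of the enveloping algebra lie in the closure of `0`: its basic open subspaces are
the left ideals `J` that contain the ideal of relations and for which `{x : E | x t ∈ J}` is open for
every `t : T` (`PreEnvelope.IsAdmissible`). This class of ideals is stable under preimage by right
multiplications, so `T` becomes a topological ring. Its separated completion is again a topological
ring with a base of left ideals, hence a topological chiral algebra, the enveloping algebra `U`.

An enveloping map `ψ : E → B` extends to `T → B`. The preimage of an open left ideal of `B` is
admissible, so the extension is continuous (`PreEnvelope.continuous_lift`) and factors uniquely
through the completion. This is the universal property of `U`.

The filtration on `U` consists of the closures of the powers of the image of `E`, with the image of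
`R` in degree `0`. For *any* enveloping map these subspaces, before closure, multiply and commute as
they should (`EnvelopingMap.preFil_mul_le`, `EnvelopingMap.commutator_mem`): in degrees `0` and `1`
this is what the axioms of an enveloping map say, since `[x, i r] = i (π(x)(r))` in `E`, and the
general case follows by the Leibniz rule. Both properties pass to closures by continuity of the
product. No injectivity of `E → U` is needed.

Finally, a morphism `X → (A₀, gr₁ A, A₁)` is determined by its component `E → A₁`, and such
components are exactly the enveloping maps `ψ : E → A` with `ψ(E) ⊆ A₁` and `ψ(i(R)) ⊆ A₀`
(`EnvelopingMap.toHom`, `EnvelopingMap.ofHom`). A homomorphism `U → A` that extends such a `ψ`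
preserves filtrations, because the filtration of `U` is generated in degrees `0` and `1` and the
subspaces `Aₙ` are closed. So the universal property of `U` is the adjunction.
-/

namespace ChiralTop

open UniformSpace Filter

/-! ### Topological algebras with a base of open left ideals -/

section LeftIdeals

/-- The closures of the left ideals in a base of `0` are a base of `0` in the completion. -/
instance isLinearTopology_completion (T : Type*) [Ring T] [UniformSpace T] [IsUniformAddGroup T]
    [IsTopologicalRing T] [IsLinearTopology T T] :
    IsLinearTopology (Completion T) (Completion T) := by
  let I (J : Ideal T) : Ideal (Completion T) :=
    { carrier := closure (Completion.coeRingHom '' (J : Set T))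
      add_mem' := fun {a b} ha hb => map_mem_closure₂ continuous_add ha hb (by
        rintro _ ⟨a, ha, rfl⟩ _ ⟨b, hb, rfl⟩
        exact ⟨a + b, J.add_mem ha hb, map_add _ a b⟩)
      zero_mem' := subset_closure ⟨0, J.zero_mem, map_zero _⟩
      smul_mem' := fun c {a} ha =>
        map_mem_closure₂ continuous_mul (Completion.denseRange_coe c) ha (by
          rintro _ ⟨b, rfl⟩ _ ⟨a, ha, rfl⟩
          exact ⟨b * a, J.mul_mem_left b ha, map_mul _ b a⟩) }
  refine IsLinearTopology.mk_of_hasBasis (S := Ideal (Completion T)) (Completion T)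
    (p := fun J : Ideal T => (J : Set T) ∈ 𝓝 0) (s := I) ?_
  refine ⟨fun U => ⟨fun hU => ?_, fun ⟨J, hJ, hJU⟩ => Filter.mem_of_superset ?_ hJU⟩⟩
  -- A topological group is regular, so a closed neighbourhood inside `U` absorbs the closure.
  · obtain ⟨V, hV, hVc, hVU⟩ := exists_mem_nhds_isClosed_subset hU
    have hV' : (Completion.coeRingHom : T → Completion T) ⁻¹' V ∈ 𝓝 0 :=
      Completion.continuous_coeRingHom.continuousAt.preimage_mem_nhds (by rwa [map_zero])
    obtain ⟨J, hJ, hJV⟩ := (IsLinearTopology.hasBasis_submodule T).mem_iff.1 hV'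
    exact ⟨J, hJ, (closure_minimal (Set.image_subset_iff.2 hJV) hVc).trans hVU⟩
  · exact Completion.isDenseInducing_coe.closure_image_mem_nhds hJ

variable (k : Type u) [Field k]

/-- A complete separated topological algebra in which the open left ideals form a base of
neighbourhoods of `0` is a topological chiral algebra. -/
def ChiralAlgebra.ofLeftIdeals (A : Type u) [Ring A] [Algebra k A] [UniformSpace A]
    [IsUniformAddGroup A] [IsTopologicalRing A] [IsLinearTopology A A] [CompleteSpace A]
    [T0Space A] : ChiralAlgebra k where
  carrier := A
  topVect :=
    { toIsTopologicalAddGroup := inferInstance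
      toT2Space := inferInstance
      toIsLinearTopology := by
        refine IsLinearTopology.mk_of_hasBasis (S := Submodule k A) k
          (p := fun J : Ideal A => (J : Set A) ∈ 𝓝 0) (s := fun J => J.restrictScalars k) ?_
        exact IsLinearTopology.hasBasis_submodule A
      complete := by rwa [IsUniformAddGroup.rightUniformSpace_eq] }
  mul_arrow Q hQ := by
    obtain ⟨J, hJ, hJQ⟩ := (IsLinearTopology.hasBasis_open_submodule A).mem_iff.1
      (hQ.mem_nhds Q.zero_mem)
    exact ⟨⟨J.restrictScalars k, hJ, fun a b hb => hJQ (J.smul_mem a hb)⟩,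
      fun b => ⟨Q.comap (LinearMap.mulRight k b), hQ.preimage (continuous_mul_const b),
        fun a ha => ha⟩⟩

namespace ChiralAlgebra

variable {k} (B : ChiralAlgebra k)

instance : IsTopologicalRing B.carrier where
  continuous_mul := IsArrowContinuous.continuous (LinearMap.mul k B.carrier) B.mul_arrow

/-- The open left ideals of a topological chiral algebra form a base of neighbourhoods of `0`:
an open subspace `Q` contains the left ideal `{a | B a ⊆ Q}`, which is open because
`B P' ⊆ Q` for some open `P'`. -/
instance : IsLinearTopology B.carrier B.carrier := by
  let I (Q : Submodule k B.carrier) : Ideal B.carrier :=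
    { carrier := {a | ∀ b, b * a ∈ Q}
      add_mem' := fun ha hb c => by rw [mul_add]; exact Q.add_mem (ha c) (hb c)
      zero_mem' := fun c => by rw [mul_zero]; exact Q.zero_mem
      smul_mem' := fun t a ha c => by rw [smul_eq_mul, ← mul_assoc]; exact ha _ }
  refine IsLinearTopology.mk_of_hasBasis (S := Ideal B.carrier) B.carrier
    (p := fun Q : Submodule k B.carrier => IsOpen (Q : Set B.carrier)) (s := I) ?_
  refine ⟨fun U => ⟨fun hU => ?_, fun ⟨Q, hQ, hQU⟩ => Filter.mem_of_superset ?_ hQU⟩⟩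
  · obtain ⟨Q, hQ, hQU⟩ := exists_open_submodule k hU
    exact ⟨Q, hQ, fun a ha => hQU (by simpa using ha 1)⟩
  · obtain ⟨P, hP, hPQ⟩ := (B.mul_arrow Q hQ).1
    exact Filter.mem_of_superset (hP.mem_nhds P.zero_mem) fun a ha b => hPQ b a ha

end ChiralAlgebra

end LeftIdeals

/-! ### The bimodule relations in a chiral extension -/

namespace ChiralLieAlgebroid

variable {k : Type u} [Field k] (X : ChiralLieAlgebroid k)

theorem lie_i (x : X.E) (r : X.R) : ⁅x, X.i r⁆ = X.i ⁅X.π x, r⁆ := by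
  have h : ⁅x, r⁆ = ⁅X.π x, r⁆ := X.π.apply_lie r x
  have h1 : ⁅x, X.i 1⁆ = 0 := by rw [← lie_skew, X.central, neg_zero]
  have h2 := LieRinehartRing.leibniz_smul_right x (X.i 1) r
  rwa [h1, smul_zero, zero_add, h, ← map_smul, ← map_smul, smul_eq_mul, smul_eq_mul, mul_one,
    mul_one] at h2

theorem i_smul (c : k) (r : X.R) : X.i (c • r) = c • X.i r := by
  rw [← mul_one r, ← smul_eq_mul, ← smul_assoc, map_smul, map_smul, smul_assoc]

end ChiralLieAlgebroid

namespace EnvelopingMap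

variable {k : Type u} [Field k] {X : ChiralLieAlgebroid k} {B : ChiralAlgebra k}

/-- A continuous map of Lie algebras that is unital and left `R`-linear is an enveloping map:
compatibility with the right action follows from `⁅x, i r⁆ = i (π(x)(r))`. -/
def ofLeft (φ : X.E →L[k] B.carrier) (map_lie : ∀ x y, φ ⁅x, y⁆ = φ x * φ y - φ y * φ x)
    (map_one : φ (X.i 1) = 1)
    (map_smul : ∀ (r : X.R) (x : X.E), φ (r • x) = φ (X.i r) * φ x) : EnvelopingMap X B where
  φ := φ
  map_lie := map_lie
  map_one := map_one
  map_mul r s := by rw [← map_smul, ← _root_.map_smul, smul_eq_mul]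
  map_smul_left := map_smul
  map_smul_right x r := by
    rw [map_add, map_smul, ← X.lie_i, map_lie]
    abel

variable (ψ : EnvelopingMap X B)

theorem map_lie_anchor (x : X.E) (r : X.R) :
    ψ.φ (X.i ⁅X.π x, r⁆) = ψ.φ x * ψ.φ (X.i r) - ψ.φ (X.i r) * ψ.φ x := by
  rw [← X.lie_i, ψ.map_lie]

/-- The restriction of `ψ` to `R`, as a linear map. -/
def restrict : X.R →ₗ[k] B.carrier where
  toFun r := ψ.φ (X.i r)
  map_add' r s := by rw [map_add, map_add]
  map_smul' c r := by rw [X.i_smul, map_smul, RingHom.id_apply]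

/-- The standard filtration before closure: the image of `R` in degree `0`, and the `n`-th power
of the image of `E` in degree `n ≥ 1`. -/
def preFil : ℕ → Submodule k B.carrier
  | 0 => LinearMap.range ψ.restrict
  | n + 1 => LinearMap.range ψ.φ.toLinearMap ^ (n + 1)

theorem mem_preFil_one {a : B.carrier} : a ∈ ψ.preFil 1 ↔ ∃ x, ψ.φ x = a := by
  rw [preFil, zero_add, pow_one]
  rfl

theorem one_mem_preFil_zero : 1 ∈ ψ.preFil 0 := ⟨1, ψ.map_one⟩

theorem preFil_zero_le_one : ψ.preFil 0 ≤ ψ.preFil 1 := by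
  rintro _ ⟨r, rfl⟩
  exact ψ.mem_preFil_one.2 ⟨X.i r, rfl⟩

theorem preFil_zero_mul_zero : ψ.preFil 0 * ψ.preFil 0 ≤ ψ.preFil 0 := by
  rw [Submodule.mul_le]
  rintro _ ⟨r, rfl⟩ _ ⟨s, rfl⟩
  exact ⟨r * s, ψ.map_mul r s⟩

theorem preFil_zero_mul_one : ψ.preFil 0 * ψ.preFil 1 ≤ ψ.preFil 1 := by
  rw [Submodule.mul_le]
  rintro _ ⟨r, rfl⟩ b hb
  obtain ⟨x, rfl⟩ := ψ.mem_preFil_one.1 hb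
  exact ψ.mem_preFil_one.2 ⟨r • x, ψ.map_smul_left r x⟩

theorem preFil_one_mul_zero : ψ.preFil 1 * ψ.preFil 0 ≤ ψ.preFil 1 := by
  rw [Submodule.mul_le]
  rintro a ha _ ⟨r, rfl⟩
  obtain ⟨x, rfl⟩ := ψ.mem_preFil_one.1 ha
  exact ψ.mem_preFil_one.2 ⟨_, ψ.map_smul_right x r⟩

theorem preFil_succ (n : ℕ) : ψ.preFil (n + 1) = ψ.preFil n * ψ.preFil 1 := by
  cases n with
  | zero =>
    refine le_antisymm (fun a ha => ?_) ψ.preFil_zero_mul_one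
    rw [← one_mul a]
    exact Submodule.mul_mem_mul ψ.one_mem_preFil_zero ha
  | succ n => rw [preFil, preFil, preFil, zero_add, pow_one, pow_succ _ (n + 1)]

theorem preFil_mul_zero (n : ℕ) : ψ.preFil n * ψ.preFil 0 ≤ ψ.preFil n := by
  cases n with
  | zero => exact ψ.preFil_zero_mul_zero
  | succ n =>
    rw [preFil_succ, mul_assoc]
    exact mul_le_mul_right ψ.preFil_one_mul_zero _

theorem preFil_mul_le (m n : ℕ) : ψ.preFil m * ψ.preFil n ≤ ψ.preFil (m + n) := by
  induction n with
  | zero => exact ψ.preFil_mul_zero m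
  | succ n ih =>
    rw [preFil_succ, ← mul_assoc, ← add_assoc, preFil_succ ψ (m + n)]
    exact mul_le_mul_left ih _

theorem mul_mem_preFil {m n : ℕ} {a b : B.carrier} (ha : a ∈ ψ.preFil m) (hb : b ∈ ψ.preFil n) :
    a * b ∈ ψ.preFil (m + n) :=
  ψ.preFil_mul_le m n (Submodule.mul_mem_mul ha hb)

theorem preFil_mono : Monotone ψ.preFil :=
  monotone_nat_of_le_succ fun n a ha => by
    rw [← mul_one a]
    exact ψ.mul_mem_preFil ha (ψ.preFil_zero_le_one ψ.one_mem_preFil_zero)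

/-- The filtration `preFil` shifted by one, with `preFil (-1) = 0`, so that the bound
`preFil (m + n - 1)` on commutators needs no case distinction. -/
def shiftFil : ℕ → Submodule k B.carrier
  | 0 => ⊥
  | n + 1 => ψ.preFil n

theorem mul_mem_shiftFil {m n : ℕ} {a b : B.carrier} (ha : a ∈ ψ.preFil m)
    (hb : b ∈ ψ.shiftFil n) : a * b ∈ ψ.shiftFil (m + n) ∧ b * a ∈ ψ.shiftFil (m + n) := by
  cases n with
  | zero =>
    obtain rfl : b = 0 := hb
    simp
  | succ n => exact ⟨ψ.mul_mem_preFil ha hb, (add_comm n m ▸ ψ.mul_mem_preFil hb ha : b * a ∈ ψ.preFil (m + n))⟩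

/-- Elements whose commutators with `preFil 0` and `preFil 1` are as small as they should be have
small commutators with every `preFil n`, by the Leibniz rule `[a, b c] = [a, b] c + b [a, c]`. -/
theorem commutator_mem_of_generators {a : B.carrier} {m : ℕ}
    (h0 : ∀ b ∈ ψ.preFil 0, a * b - b * a ∈ ψ.shiftFil m)
    (h1 : ∀ b ∈ ψ.preFil 1, a * b - b * a ∈ ψ.shiftFil (m + 1)) (n : ℕ) :
    ∀ b ∈ ψ.preFil n, a * b - b * a ∈ ψ.shiftFil (m + n) := by
  induction n with
  | zero => exact h0
  | succ n ih =>
    intro b hb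
    rw [preFil_succ] at hb
    induction hb using Submodule.mul_induction_on' with
    | mem_mul_mem b hb c hc =>
      have e : a * (b * c) - b * c * a = (a * b - b * a) * c + b * (a * c - c * a) := by
        noncomm_ring
      rw [e]
      refine add_mem ?_ ?_
      · have := (ψ.mul_mem_shiftFil hc (ih b hb)).2
        rwa [add_comm, add_assoc] at this
      · have := (ψ.mul_mem_shiftFil hb (h1 c hc)).1
        rwa [add_left_comm] at this
    | add b _ c _ hb hc =>
      have e : a * (b + c) - (b + c) * a = (a * b - b * a) + (a * c - c * a) := by
        noncomm_ring
      rw [e]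
      exact add_mem hb hc

/-- The commutator of `preFil m` and `preFil n` lies in `preFil (m + n - 1)`. The low degrees are
the axioms of an enveloping map; the Leibniz rule then raises one degree at a time. -/
theorem commutator_mem (m n : ℕ) : ∀ a ∈ ψ.preFil m, ∀ b ∈ ψ.preFil n,
    a * b - b * a ∈ ψ.shiftFil (m + n) := by
  have h00 : ∀ a ∈ ψ.preFil 0, ∀ b ∈ ψ.preFil 0, a * b - b * a ∈ ψ.shiftFil 0 := by
    rintro _ ⟨r, rfl⟩ _ ⟨s, rfl⟩
    have : ψ.restrict r * ψ.restrict s = ψ.restrict s * ψ.restrict r := by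
      change ψ.φ _ * ψ.φ _ = ψ.φ _ * ψ.φ _
      rw [← ψ.map_mul, ← ψ.map_mul, mul_comm]
    rw [this, sub_self]
    exact zero_mem _
  have h10 : ∀ a ∈ ψ.preFil 1, ∀ b ∈ ψ.preFil 0, a * b - b * a ∈ ψ.shiftFil 1 := by
    rintro a ha _ ⟨r, rfl⟩
    obtain ⟨x, rfl⟩ := ψ.mem_preFil_one.1 ha
    exact ⟨_, ψ.map_lie_anchor x r⟩
  have h11 : ∀ a ∈ ψ.preFil 1, ∀ b ∈ ψ.preFil 1, a * b - b * a ∈ ψ.shiftFil 2 := by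
    rintro a ha b hb
    obtain ⟨x, rfl⟩ := ψ.mem_preFil_one.1 ha
    obtain ⟨y, rfl⟩ := ψ.mem_preFil_one.1 hb
    exact ψ.mem_preFil_one.2 ⟨_, ψ.map_lie x y⟩
  have swap : ∀ {p : ℕ} {a b : B.carrier}, a * b - b * a ∈ ψ.shiftFil p →
      b * a - a * b ∈ ψ.shiftFil p := fun h => by
    rw [← neg_sub]
    exact neg_mem h
  -- Raise the degree of the one factor against `preFil 0` and `preFil 1`, then that of the other.
  have h0 : ∀ b ∈ ψ.preFil 0, ∀ a ∈ ψ.preFil m, b * a - a * b ∈ ψ.shiftFil m := fun b hb => by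
    simpa using ψ.commutator_mem_of_generators (m := 0) (h00 b hb)
      (fun a ha => swap (h10 a ha b hb)) m
  have h1 : ∀ b ∈ ψ.preFil 1, ∀ a ∈ ψ.preFil m, b * a - a * b ∈ ψ.shiftFil (m + 1) :=
    fun b hb => add_comm 1 m ▸ ψ.commutator_mem_of_generators (m := 1) (h10 b hb) (h11 b hb) m
  exact fun a ha => ψ.commutator_mem_of_generators (fun b hb => swap (h0 b hb a ha))
    (fun b hb => swap (h1 b hb a ha)) n

/-- If `ψ` generates a dense subalgebra of `B`, the closures of the powers of its image are a
commutative filtration on `B`. -/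
def filtered (hψ : Dense (⋃ n, (ψ.preFil n : Set B.carrier))) : FilteredChiralAlgebra k where
  toChiralAlgebra := B
  fil n :=
    have : ContinuousConstSMul k B.carrier := IsScalarTower.continuousConstSMul
    (ψ.preFil n).topologicalClosure
  mono _ _ h := closure_mono (ψ.preFil_mono h)
  isClosed_fil _ := isClosed_closure
  dense_fil := hψ.mono (Set.iUnion_mono fun _ => subset_closure)
  one_mem := subset_closure ψ.one_mem_preFil_zero
  mul_mem _ _ _ ha _ hb := map_mem_closure₂ continuous_mul ha hb fun _ ha _ hb =>
    ψ.mul_mem_preFil ha hb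
  comm_zero a ha b hb := by
    have h : a * b - b * a ∈ closure {(0 : B.carrier)} :=
      map_mem_closure₂ (f := fun a b : B.carrier => a * b - b * a) (by fun_prop) ha hb
        fun a ha b hb => ψ.commutator_mem 0 0 a ha b hb
    rw [closure_singleton] at h
    exact sub_eq_zero.1 h
  comm_succ m n l h a ha b hb :=
    map_mem_closure₂ (f := fun a b : B.carrier => a * b - b * a) (by fun_prop) ha hb
      fun a ha b hb => by
        have := ψ.commutator_mem m n a ha b hb
        rwa [h] at this

end EnvelopingMap

/-! ### The chiral enveloping algebra -/

section Envelope

variable {k : Type u} [Field k] (X : ChiralLieAlgebroid k)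

/-- The tensor algebra of `E`, to be equipped with the linear topology whose basic open subspaces
are the admissible left ideals (`PreEnvelope.IsAdmissible`). This topology is not separated: the
relations of the enveloping algebra lie in the closure of `0`, so they hold in the completion. -/
def PreEnvelope : Type u := TensorAlgebra k X.E

namespace PreEnvelope

instance : Ring (PreEnvelope X) := inferInstanceAs (Ring (TensorAlgebra k X.E))

instance : Algebra k (PreEnvelope X) := inferInstanceAs (Algebra k (TensorAlgebra k X.E))

/-- The canonical map from `E`. -/
def ι : X.E →ₗ[k] PreEnvelope X := TensorAlgebra.ι k

variable {X} in
/-- The algebra homomorphism extending a linear map on `E`. -/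
def lift {A : Type*} [Ring A] [Algebra k A] (f : X.E →ₗ[k] A) : PreEnvelope X →ₐ[k] A :=
  TensorAlgebra.lift k f

variable {X} in
@[simp]
theorem lift_ι {A : Type*} [Ring A] [Algebra k A] (f : X.E →ₗ[k] A) (x : X.E) :
    lift f (ι X x) = f x :=
  TensorAlgebra.lift_ι_apply f x

variable {X} in
theorem hom_ext {A : Type*} [Ring A] [Algebra k A] {f g : PreEnvelope X →ₐ[k] A}
    (h : ∀ x, f (ι X x) = g (ι X x)) : f = g :=
  TensorAlgebra.hom_ext (LinearMap.ext h)

variable {X} in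
theorem induction {C : PreEnvelope X → Prop} (algebraMap : ∀ c : k, C (algebraMap k _ c))
    (ι : ∀ x, C (ι X x)) (mul : ∀ a b, C a → C b → C (a * b))
    (add : ∀ a b, C a → C b → C (a + b)) (a : PreEnvelope X) : C a :=
  TensorAlgebra.induction algebraMap ι mul add a

/-- The relations defining the enveloping algebra of `X` as a quotient of the tensor algebra of
`E`: the bracket of `E` is the commutator, `i 1` is the unit, and the left action of `R` is left
multiplication. -/
inductive Rel : PreEnvelope X → PreEnvelope X → Prop
  | lie (x y : X.E) : Rel (ι X ⁅x, y⁆) (ι X x * ι X y - ι X y * ι X x)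
  | one : Rel (ι X (X.i 1)) 1
  | smul (r : X.R) (x : X.E) : Rel (ι X (r • x)) (ι X (X.i r) * ι X x)

/-- A left ideal `J` is admissible if it contains the two-sided ideal of relations and if, for
every `t`, the set of `x : E` with `x t ∈ J` is open. These are the conditions that the preimages
of open left ideals along homomorphisms to topological chiral algebras satisfy. -/
structure IsAdmissible (J : Ideal (PreEnvelope X)) : Prop where
  isOpen : ∀ t, IsOpen {x : X.E | ι X x * t ∈ J}
  rel_mem : ∀ a b t, Rel X a b → (a - b) * t ∈ J

variable {X} in
theorem IsAdmissible.inf {I J : Ideal (PreEnvelope X)} (hI : IsAdmissible X I)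
    (hJ : IsAdmissible X J) : IsAdmissible X (I ⊓ J) where
  isOpen t := (hI.isOpen t).inter (hJ.isOpen t)
  rel_mem a b t h := ⟨hI.rel_mem a b t h, hJ.rel_mem a b t h⟩

variable {X} in
/-- Admissibility is stable under preimage by right multiplication. This is what makes right
multiplications continuous. -/
theorem IsAdmissible.comap_mul_right {J : Ideal (PreEnvelope X)} (hJ : IsAdmissible X J)
    (s : PreEnvelope X) :
    IsAdmissible X (Submodule.comap (LinearMap.toSpanSingleton (PreEnvelope X) _ s) J) where
  isOpen t := by simpa [mul_assoc] using hJ.isOpen (t * s)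
  rel_mem a b t h := by simpa [mul_assoc] using hJ.rel_mem a b (t * s) h

theorem ringSubgroupsBasis_admissible :
    RingSubgroupsBasis fun J : {J : Ideal (PreEnvelope X) // IsAdmissible X J} =>
      (J : Ideal (PreEnvelope X)).toAddSubgroup where
  inter I J := ⟨⟨I ⊓ J, I.2.inf J.2⟩, le_rfl⟩
  mul J := ⟨J, by
    rintro _ ⟨a, -, b, hb, rfl⟩
    exact J.1.mul_mem_left a hb⟩
  leftMul t J := ⟨J, fun _ hb => J.1.mul_mem_left t hb⟩
  rightMul t J := ⟨⟨_, J.2.comap_mul_right t⟩, fun _ ha => ha⟩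

instance : Nonempty {J : Ideal (PreEnvelope X) // IsAdmissible X J} :=
  ⟨⟨⊤, ⟨fun _ => by simp, fun _ _ _ _ => trivial⟩⟩⟩

instance : TopologicalSpace (PreEnvelope X) := (ringSubgroupsBasis_admissible X).topology

instance : IsTopologicalRing (PreEnvelope X) :=
  (ringSubgroupsBasis_admissible X).toRingFilterBasis.isTopologicalRing

instance : UniformSpace (PreEnvelope X) := IsTopologicalAddGroup.rightUniformSpace _

instance : IsUniformAddGroup (PreEnvelope X) := isUniformAddGroup_of_addCommGroup

instance : ContinuousConstSMul k (PreEnvelope X) := IsScalarTower.continuousConstSMul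

instance : UniformContinuousConstSMul k (PreEnvelope X) :=
  uniformContinuousConstSMul_of_continuousConstSMul _ _

theorem hasBasis_nhds_zero : (𝓝 (0 : PreEnvelope X)).HasBasis (IsAdmissible X)
    fun J => (J : Set (PreEnvelope X)) :=
  ((ringSubgroupsBasis_admissible X).hasBasis_nhds_zero).to_hasBasis
    (fun J _ => ⟨J, J.2, le_rfl⟩) (fun J hJ => ⟨⟨J, hJ⟩, trivial, le_rfl⟩)

instance : IsLinearTopology (PreEnvelope X) (PreEnvelope X) :=
  IsLinearTopology.mk_of_hasBasis (S := Ideal (PreEnvelope X)) _ (hasBasis_nhds_zero X)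

theorem continuous_ι : Continuous (ι X) := by
  refine continuous_of_continuousAt_zero (ι X) ?_
  rw [ContinuousAt, map_zero, (hasBasis_nhds_zero X).tendsto_right_iff]
  intro J hJ
  have := hJ.isOpen 1
  simp only [mul_one] at this
  exact this.mem_nhds (by simp)

/-- The canonical homomorphism to the completion. -/
def coeAlgHom : PreEnvelope X →ₐ[k] Completion (PreEnvelope X) :=
  { Completion.coeRingHom with commutes' := fun _ => rfl }

theorem continuous_coeAlgHom : Continuous (coeAlgHom X) := Completion.continuous_coe _

theorem denseRange_coeAlgHom : DenseRange (coeAlgHom X) := Completion.denseRange_coe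

variable {X} in
/-- The relations lie in every admissible left ideal, hence vanish in the completion. -/
theorem coeAlgHom_eq_of_rel {a b : PreEnvelope X} (h : Rel X a b) :
    coeAlgHom X a = coeAlgHom X b := by
  have h0 : (a - b) ⤳ 0 := specializes_iff_pure.2 <| (hasBasis_nhds_zero X).ge_iff.2
    fun J hJ => by simpa using hJ.rel_mem a b 1 h
  rw [← sub_eq_zero, ← map_sub, ← map_zero (coeAlgHom X)]
  exact (h0.map (continuous_coeAlgHom X)).eq

variable {X} in
/-- An enveloping map to `B` extends to a continuous homomorphism: the preimage of an open left
ideal is admissible. -/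
theorem continuous_lift {B : ChiralAlgebra k} (ψ : EnvelopingMap X B) :
    Continuous (lift ψ.φ.toLinearMap) := by
  have hι (x : X.E) : lift ψ.φ.toLinearMap (ι X x) = ψ.φ x := lift_ι _ x
  set f := lift ψ.φ.toLinearMap
  have hrel {a b : PreEnvelope X} (h : Rel X a b) : f a = f b := by
    cases h with
    | lie x y => simp only [map_sub, map_mul, hι, ψ.map_lie]
    | one => rw [hι, ψ.map_one, map_one]
    | smul r x => simp only [map_mul, hι, ψ.map_smul_left]
  refine continuous_of_continuousAt_zero f ?_
  rw [ContinuousAt, map_zero,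
    (IsLinearTopology.hasBasis_open_ideal (R := B.carrier)).tendsto_right_iff]
  intro J hJ
  refine (hasBasis_nhds_zero X).mem_iff.2 ⟨J.comap f, ⟨fun t => ?_, fun a b t h => ?_⟩, le_rfl⟩
  · simp only [Ideal.mem_comap, map_mul, hι]
    exact hJ.preimage (ψ.φ.continuous.mul continuous_const)
  · rw [Ideal.mem_comap, map_mul, map_sub, hrel h, sub_self, zero_mul]
    exact J.zero_mem

end PreEnvelope

open PreEnvelope

/-- The chiral enveloping algebra of `X`. -/
noncomputable def chiralEnvelope : ChiralAlgebra k :=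
  ChiralAlgebra.ofLeftIdeals k (Completion (PreEnvelope X))

/-- The homomorphism from the tensor algebra of `E` to the chiral enveloping algebra. -/
noncomputable def toEnvelope : PreEnvelope X →ₐ[k] (chiralEnvelope X).carrier := coeAlgHom X

theorem continuous_toEnvelope : Continuous (toEnvelope X) := continuous_coeAlgHom X

theorem denseRange_toEnvelope : DenseRange (toEnvelope X) := denseRange_coeAlgHom X

variable {X} in
theorem toEnvelope_eq_of_rel {a b : PreEnvelope X} (h : Rel X a b) :
    toEnvelope X a = toEnvelope X b :=
  coeAlgHom_eq_of_rel h

/-- The universal enveloping map. -/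
noncomputable def envelopeUnit : EnvelopingMap X (chiralEnvelope X) :=
  EnvelopingMap.ofLeft
    { (toEnvelope X).toLinearMap ∘ₗ ι X with
      cont := (continuous_toEnvelope X).comp (continuous_ι X) }
    (fun x y => (toEnvelope_eq_of_rel (.lie x y)).trans (by
      rw [map_sub, map_mul, map_mul]
      rfl))
    ((toEnvelope_eq_of_rel .one).trans (map_one _))
    (fun r x => (toEnvelope_eq_of_rel (.smul r x)).trans (map_mul _ _ _))

variable {X} in
/-- A continuous homomorphism of algebras into a topological chiral algebra extends to the
completion. -/
theorem exists_extension {B : ChiralAlgebra k} {f : PreEnvelope X →ₐ[k] B.carrier}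
    (hf : Continuous f) : ∃ g : (chiralEnvelope X).carrier →A[k] B.carrier,
      ∀ t, g (toEnvelope X t) = f t := by
  let : UniformSpace B.carrier := IsTopologicalAddGroup.rightUniformSpace B.carrier
  have : IsUniformAddGroup B.carrier := isUniformAddGroup_of_addCommGroup
  have : CompleteSpace B.carrier := B.topVect.complete
  have h (t : PreEnvelope X) : Completion.extensionHom f.toRingHom hf t = f t :=
    Completion.extensionHom_coe f.toRingHom hf t
  exact ⟨{ Completion.extensionHom f.toRingHom hf with
    commutes' := fun c => (h _).trans (f.commutes c)
    cont := Completion.continuous_extension }, h⟩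

theorem isChiralEnvelope_chiralEnvelope :
    IsChiralEnvelope X (chiralEnvelope X) (envelopeUnit X) := by
  intro B ψ
  obtain ⟨g, hg⟩ := exists_extension (continuous_lift ψ)
  refine ⟨g, fun x => (hg _).trans (lift_ι _ _), fun g' hg' => ?_⟩
  have h : (g' : (chiralEnvelope X).carrier →ₐ[k] B.carrier).comp (toEnvelope X) =
      lift ψ.φ.toLinearMap := hom_ext fun x => (hg' x).trans (lift_ι _ _).symm
  refine ContinuousAlgHom.ext fun a => congrFun ((denseRange_toEnvelope X).equalizer
    g'.cont g.cont (funext fun t => ?_)) a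
  exact (DFunLike.congr_fun h t).trans (hg t).symm

theorem dense_iUnion_preFil :
    Dense (⋃ n, ((envelopeUnit X).preFil n : Set (chiralEnvelope X).carrier)) := by
  refine (denseRange_toEnvelope X).mono ?_
  rintro _ ⟨t, rfl⟩
  rw [Set.mem_iUnion]
  induction t using PreEnvelope.induction with
  | algebraMap c =>
    refine ⟨0, ?_⟩
    rw [AlgHom.commutes, Algebra.algebraMap_eq_smul_one]
    exact Submodule.smul_mem _ c (envelopeUnit X).one_mem_preFil_zero
  | ι x => exact ⟨1, (envelopeUnit X).mem_preFil_one.2 ⟨x, rfl⟩⟩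
  | mul a b ha hb =>
    obtain ⟨m, ha⟩ := ha
    obtain ⟨n, hb⟩ := hb
    rw [map_mul]
    exact ⟨m + n, (envelopeUnit X).mul_mem_preFil ha hb⟩
  | add a b ha hb =>
    obtain ⟨m, ha⟩ := ha
    obtain ⟨n, hb⟩ := hb
    rw [map_add]
    exact ⟨max m n, add_mem ((envelopeUnit X).preFil_mono (le_max_left m n) ha)
      ((envelopeUnit X).preFil_mono (le_max_right m n) hb)⟩

/-- The chiral enveloping algebra with its standard filtration. -/
noncomputable def filteredEnvelope : FilteredChiralAlgebra k :=
  (envelopeUnit X).filtered (dense_iUnion_preFil X)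

theorem isStandardFiltration_filteredEnvelope :
    IsStandardFiltration X (filteredEnvelope X) (envelopeUnit X) :=
  ⟨rfl, fun n hn => by
    obtain ⟨n, rfl⟩ := Nat.exists_eq_add_of_le' hn
    rfl⟩

end Envelope

/-! ### The adjunction -/

section Adjunction

variable {k : Type u} [Field k] {X : ChiralLieAlgebroid k}

/-- A morphism of topological chiral Lie algebroids is determined by its component on `E`. -/
theorem ChiralLieAlgebroid.Hom.ext_fE {Y : ChiralLieAlgebroid k} {f g : Hom X Y}
    (h : ∀ x, f.fE x = g.fE x) : f = g := by
  refine Hom.ext' (fun r => Y.isClosedEmbedding_i.injective ?_) (fun x => ?_) h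
  · rw [← f.comm_i, ← g.comm_i, h]
  · obtain ⟨x, rfl⟩ := X.isOpenQuotientMap_π.surjective x
    rw [← f.comm_π, ← g.comm_π, h]

variable {A : FilteredChiralAlgebra k}

namespace EnvelopingMap

variable (ψ : EnvelopingMap X A.toChiralAlgebra) (h0 : ∀ r, ψ.φ (X.i r) ∈ A.fil 0)
  (h1 : ∀ x, ψ.φ x ∈ A.fil 1)

/-- The map `R → A₀` underlying an enveloping map compatible with filtrations. -/
def hom₀ : X.R →A[k] A.A₀ where
  toFun r := ⟨ψ.φ (X.i r), h0 r⟩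
  map_one' := Subtype.ext ψ.map_one
  map_mul' r s := Subtype.ext (ψ.map_mul r s)
  map_zero' := Subtype.ext (map_zero ψ.restrict)
  map_add' r s := Subtype.ext (map_add ψ.restrict r s)
  commutes' c := Subtype.ext (by
    change ψ.restrict (algebraMap k X.R c) = algebraMap k A.carrier c
    rw [Algebra.algebraMap_eq_smul_one, Algebra.algebraMap_eq_smul_one, map_smul]
    exact congrArg (c • ·) ψ.map_one)
  cont := (ψ.φ.cont.comp X.isClosedEmbedding_i.continuous).subtype_mk _

/-- The map `E → A₁` underlying an enveloping map compatible with filtrations. -/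
def hom₁ : X.E →ₗ⁅(ψ.hom₀ h0 : X.R →ₐ[k] A.A₀)⁆ A.A₁ where
  toFun x := ⟨ψ.φ x, h1 x⟩
  map_add' x y := Subtype.ext (map_add ψ.φ x y)
  map_smul' c x := Subtype.ext (map_smul ψ.φ c x)
  map_lie' {x y} := Subtype.ext (ψ.map_lie x y)
  map_smul_apply' r x := Subtype.ext (ψ.map_smul_left r x)
  apply_lie' r x := Subtype.ext (by
    have h : ⁅x, r⁆ = ⁅X.π x, r⁆ := X.π.apply_lie r x
    change ψ.φ (X.i ⁅x, r⁆) = _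
    rw [h, ψ.map_lie_anchor]
    rfl)

/-- Since `L = E / i(R)`, the map `L → gr₁ A` may be computed on any lift to `E`. -/
theorem proj_hom₁_eq {x y : X.E} (h : X.π x = X.π y) :
    A.proj (ψ.hom₁ h0 h1 x) = A.proj (ψ.hom₁ h0 h1 y) := by
  obtain ⟨r, hr⟩ := (X.exact (x - y)).1 (by rw [map_sub, h, sub_self])
  rw [← sub_eq_zero, ← map_sub, ← map_sub, ← hr]
  exact A.proj_eq_zero.2 ⟨ψ.hom₀ h0 r, rfl⟩

/-- The map `L → gr₁ A` underlying an enveloping map compatible with filtrations. -/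
noncomputable def homGr : X.L →ₗ⁅(ψ.hom₀ h0 : X.R →ₐ[k] A.A₀)⁆ A.gr₁ :=
  have hs := Function.surjInv_eq X.isOpenQuotientMap_π.surjective
  { toFun x := A.proj (ψ.hom₁ h0 h1 (Function.surjInv X.isOpenQuotientMap_π.surjective x))
    map_add' x y := by
      rw [← map_add, ← map_add]
      exact ψ.proj_hom₁_eq h0 h1 (by rw [map_add, hs, hs, hs])
    map_smul' c x := by
      rw [RingHom.id_apply, ← map_smul, ← map_smul]
      exact ψ.proj_hom₁_eq h0 h1 (by rw [map_smul, hs, hs])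
    map_lie' {x y} := by
      rw [← LieHom.map_lie, ← LieHom.map_lie]
      exact ψ.proj_hom₁_eq h0 h1 (by rw [LieHom.map_lie, hs, hs, hs])
    map_smul_apply' r x := by
      refine Eq.trans ?_ (congrArg A.proj ((ψ.hom₁ h0 h1).map_smul_apply r _))
      refine ψ.proj_hom₁_eq h0 h1 ?_
      rw [hs]
      refine Eq.trans ?_ (X.π.map_smul_apply r _).symm
      rw [hs]
      rfl
    apply_lie' r x := by
      have h : ⁅Function.surjInv X.isOpenQuotientMap_π.surjective x, r⁆ = ⁅x, r⁆ :=
        (X.π.apply_lie r _).trans (by rw [hs]; rfl)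
      rw [← h]
      exact (ψ.hom₁ h0 h1).apply_lie r _ }

theorem homGr_π (x : X.E) : ψ.homGr h0 h1 (X.π x) = A.proj (ψ.hom₁ h0 h1 x) :=
  ψ.proj_hom₁_eq h0 h1 (Function.surjInv_eq X.isOpenQuotientMap_π.surjective _)

theorem continuous_hom₁ : Continuous (ψ.hom₁ h0 h1) := ψ.φ.cont.subtype_mk _

/-- An enveloping map `ψ` with `ψ(i(R)) ⊆ A₀` and `ψ(E) ⊆ A₁` is a morphism of topological chiral
Lie algebroids `X → (A₀, gr₁ A, A₁)`. -/
noncomputable def toHom : X ⟶ (FilteredChiralAlgebra.algebroidFunctor k).obj A :=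
  { fR := ψ.hom₀ h0
    fL := ψ.homGr h0 h1
    fE := ψ.hom₁ h0 h1
    continuous_fL := by
      rw [← X.isOpenQuotientMap_π.continuous_comp_iff]
      exact (A.continuous_proj.comp (ψ.continuous_hom₁ h0 h1)).congr
        fun x => (ψ.homGr_π h0 h1 x).symm
    continuous_fE := ψ.continuous_hom₁ h0 h1
    comm_i := fun _ => rfl
    comm_π := fun x => (ψ.homGr_π h0 h1 x).symm : ChiralLieAlgebroid.Hom X A.toAlgebroid }

/-- The enveloping map underlying a morphism `X → (A₀, gr₁ A, A₁)`. -/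
def ofHom (g : ChiralLieAlgebroid.Hom X A.toAlgebroid) : EnvelopingMap X A.toChiralAlgebra :=
  have hi (r : X.R) : (A.fil 1).subtype (g.fE (X.i r)) = (g.fR r).1 :=
    congrArg (A.fil 1).subtype (g.comm_i r)
  ofLeft
    { (A.fil 1).subtype ∘ₗ g.fE.toLieHom.toLinearMap with
      cont := continuous_subtype_val.comp g.continuous_fE }
    (fun x y => congrArg (A.fil 1).subtype (LieHom.map_lie g.fE.toLieHom x y))
    ((hi 1).trans (congrArg Subtype.val (_root_.map_one g.fR)))
    (fun r x => (congrArg (A.fil 1).subtype (g.fE.map_smul_apply r x)).trans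
      (congrArg (· * (A.fil 1).subtype (g.fE x)) (hi r).symm))

theorem ofHom_mem_zero (g : ChiralLieAlgebroid.Hom X A.toAlgebroid) (r : X.R) :
    (ofHom g).φ (X.i r) ∈ A.fil 0 := by
  have : (ofHom g).φ (X.i r) = (g.fR r).1 := congrArg (A.fil 1).subtype (g.comm_i r)
  rw [this]
  exact (g.fR r).2

theorem ofHom_mem_one (g : ChiralLieAlgebroid.Hom X A.toAlgebroid) (x : X.E) :
    (ofHom g).φ x ∈ A.fil 1 :=
  (g.fE x).2

/-- The image of the standard filtration under a homomorphism to a filtered algebra `A` is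
determined in degrees `0` and `1`. -/
theorem map_preFil_mem {B : ChiralAlgebra k} (η : EnvelopingMap X B)
    (f : B.carrier →A[k] A.carrier) (h0 : ∀ r, f (η.φ (X.i r)) ∈ A.fil 0)
    (h1 : ∀ x, f (η.φ x) ∈ A.fil 1) (n : ℕ) : ∀ a ∈ η.preFil n, f a ∈ A.fil n := by
  induction n with
  | zero =>
    rintro _ ⟨r, rfl⟩
    exact h0 r
  | succ n ih =>
    suffices h : η.preFil n * η.preFil 1 ≤ (A.fil (n + 1)).comap f.toAlgHom.toLinearMap by
      rw [η.preFil_succ]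
      exact h
    rw [Submodule.mul_le]
    intro a ha b hb
    obtain ⟨x, rfl⟩ := η.mem_preFil_one.1 hb
    have := A.mul_mem n 1 _ (ih a ha) _ (h1 x)
    rwa [← _root_.map_mul] at this

end EnvelopingMap

variable (X) in
/-- The unit of the adjunction, induced by the universal enveloping map. -/
noncomputable def envelopeUnitHom :
    X ⟶ (FilteredChiralAlgebra.algebroidFunctor k).obj (filteredEnvelope X) :=
  EnvelopingMap.toHom (A := filteredEnvelope X) (envelopeUnit X)
    (fun r => subset_closure ⟨r, rfl⟩)
    (fun x => subset_closure ((envelopeUnit X).mem_preFil_one.2 ⟨x, rfl⟩))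

theorem bijective_envelopeUnitHom_comp : Function.Bijective fun f : filteredEnvelope X ⟶ A =>
    envelopeUnitHom X ≫ (FilteredChiralAlgebra.algebroidFunctor k).map f := by
  constructor
  · intro f g hfg
    refine FilteredChiralAlgebra.Hom.ext ((isChiralEnvelope_chiralEnvelope X A.toChiralAlgebra
      (.ofHom (envelopeUnitHom X ≫ (FilteredChiralAlgebra.algebroidFunctor k).map g))).unique
      (fun x => ?_) (fun x => rfl))
    exact congrArg (fun h : ChiralLieAlgebroid.Hom X A.toAlgebroid =>
      (EnvelopingMap.ofHom h).φ x) hfg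
  · intro g
    obtain ⟨f, hf, -⟩ := isChiralEnvelope_chiralEnvelope X A.toChiralAlgebra (.ofHom g)
    have hfil := (envelopeUnit X).map_preFil_mem f
      (fun r => (hf _).symm ▸ EnvelopingMap.ofHom_mem_zero g r)
      (fun x => (hf x).symm ▸ EnvelopingMap.ofHom_mem_one g x)
    refine ⟨⟨f, fun n a ha => (A.isClosed_fil n).closure_subset
      (map_mem_closure f.cont ha (hfil n))⟩, ?_⟩
    exact ChiralLieAlgebroid.Hom.ext_fE fun x => Subtype.ext (hf x)

variable (X A) in
/-- Filtered homomorphisms from the enveloping algebra of `X` to `A` are morphisms from `X` to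
`(A₀, gr₁ A, A₁)`. -/
noncomputable def envelopeHomEquiv :
    (filteredEnvelope X ⟶ A) ≃ (X ⟶ (FilteredChiralAlgebra.algebroidFunctor k).obj A) :=
  Equiv.ofBijective _ bijective_envelopeUnitHom_comp

theorem envelopeHomEquiv_comp (X : ChiralLieAlgebroid k) (A B : FilteredChiralAlgebra k)
    (g : A ⟶ B) (h : filteredEnvelope X ⟶ A) : envelopeHomEquiv X B (h ≫ g) =
      envelopeHomEquiv X A h ≫ (FilteredChiralAlgebra.algebroidFunctor k).map g := by
  change envelopeUnitHom X ≫ _ = (envelopeUnitHom X ≫ _) ≫ _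
  rw [Functor.map_comp, Category.assoc]

end Adjunction
end ChiralTop

theorem mainTheorem4 (k : Type u) [Field k] :
    ∃ (F : ChiralTop.ChiralLieAlgebroid k ⥤ ChiralTop.FilteredChiralAlgebra k)
      (adj : F ⊣ ChiralTop.FilteredChiralAlgebra.algebroidFunctor k),
      ∀ X : ChiralTop.ChiralLieAlgebroid k,
        ∃ η : ChiralTop.EnvelopingMap X (F.obj X).toChiralAlgebra,
          (∀ x : X.E, η.φ x = Subtype.val (p := fun a => a ∈ (F.obj X).fil 1)
            (ChiralTop.ChiralLieAlgebroid.Hom.fE (adj.unit.app X) x)) ∧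
          ChiralTop.IsChiralEnvelope X (F.obj X).toChiralAlgebra η ∧
          ChiralTop.IsStandardFiltration X (F.obj X) η := by
  refine ⟨_, Adjunction.adjunctionOfEquivLeft (fun X A => ChiralTop.envelopeHomEquiv X A)
    ChiralTop.envelopeHomEquiv_comp, fun X => ⟨ChiralTop.envelopeUnit X, fun x => ?_,
      ChiralTop.isChiralEnvelope_chiralEnvelope X,
      ChiralTop.isStandardFiltration_filteredEnvelope X⟩⟩
  rw [Adjunction.adjunctionOfEquivLeft_unit_app]
  rfl
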